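/- Let $\Sigma=\{a,b\}$, write $|w|_c$ for the number of occurrences of the letter $c$ in a word $w$ and $|w|$ for its length, and let $\mathsf{SQRT}=\{w\in\{a,b\}^* : |w|_a<|w|/\sqrt2\}$. A ReLU network is a nonempty composition of layers $\mathbb{Q}^m\to\mathbb{Q}^n$ whose output coordinates have the form $x\mapsto\max(0,\beta+\sum_i w_ix_i)$ with rational $\beta,w_i$. An average hard attention (AHA) layer is given by affine maps $Q,K:\mathbb{Q}^d\to\mathbb{Q}^m$, $V:\mathbb{Q}^d\to\mathbb{Q}^k$ and a ReLU network $N:\mathbb{Q}^{d+k}\to\mathbb{Q}^e$; it maps a sequence $(x_1,\dots,x_n)$ to $(y_1,\dots,y_n)$ with $y_i=N(x_i,a_i)$, where $a_i$ is the average of $Vx_j$ over all $j$ for which $\langle Kx_i,Qx_j\rangle$ is maximal. An average hard attention transformer (AHAT) over $\Sigma$ consists of an embedding $\iota:\Sigma\to\mathbb{Q}^{d}$, a positional encoding $p:\mathbb{N}^2\to\mathbb{Q}^{d}$ and a finite sequence of AHA layers; it is a NoPE-AHAT if $p$ is constant. Without end marker, it recognises the set of nonempty words $w=c_1\cdots c_n$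 for which applying the layers in order to $(\iota(c_1)+p(n,1),\dots,\iota(c_n)+p(n,n))$ gives a sequence whose last vector has positive first coordinate. The logic $\mathsf{LTL[Count]}$ has formulas $\varphi::=c\mid t\le t\mid\neg\varphi\mid\varphi\lor\varphi\mid \mathrm{X}\varphi\mid\varphi\,\mathrm{U}\,\varphi$ with $c\in\Sigma$, and terms $t::=k\mid k\cdot\overleftarrow{\#\varphi}\mid k\cdot\overrightarrow{\#\varphi}\mid t+t$ with $k\in\mathbb{Z}$. They are evaluated at positions of finite words in the usual way, where at position $i$ of $w$ the term $k\cdot\overleftarrow{\#\varphi}$ is $k$ times the number of positions $j<i$ satisfying $\varphi$, and $k\cdot\overrightarrow{\#\varphi}$ is $k$ times the number of positions $j$ with $i\le j\le|w|$ satisfying $\varphi$. The language of a formula is the set of nonempty words that satisfy it at their first position. A simplified multicounter machine has a finite state set $S$, a start state $q_0$, finitely many integer counters $z\in\mathbb{Z}^d$, a transition function $\delta:S\times\Sigma\times\{0,1\}^d\to S$, an update function $u$ that assigns to each letter and each counter one of the operations $+1$, $-1$, set to $0$, leave unchanged, and a set $F\subseteq S\times\{0,1\}^d$. Let $\operatorname{mask}(z)\in\{0,1\}^d$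 have $i$-th entry $0$ if and only if $z_i=0$. Reading $c\in\Sigma$ in configuration $(q,z)$ leads to state $\delta(q,c,\operatorname{mask}(z))$ and applies $u(c)$ to the counters. A word is accepted if the run on it from $(q_0,0)$ ends in a configuration $(q,z)$ with $(q,\operatorname{mask}(z))\in F$. Then: 1. $\mathsf{SQRT}$ is recognised without end marker by a NoPE-AHAT with exactly two AHA layers. 2. The Parikh image $\{(|w|_a,|w|_b) : w\in\mathsf{SQRT}\}\subseteq\mathbb{N}^2$ is not semilinear, i.e. not a finite union of sets $v+\{\sum_{i=1}^r n_iv_i : n_i\in\mathbb{N}\}$ with $v,v_1,\dots,v_r\in\mathbb{N}^2$. 3. $\mathsf{SQRT}$ is not the language of any $\mathsf{LTL[Count]}$ formula. 4. $\mathsf{SQRT}$ is not accepted by any simplified multicounter machine. -/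

import Mathlib

namespace CountLang

/-! ### ReLU networks and average hard attention transformers -/

/-- A ReLU node with `m` rational inputs. -/
structure ReLUNode (m : ℕ) where
  weight : Fin m → ℚ
  bias : ℚ

/-- `v(x) = max(0, b + ∑ i, w i * x i)`. -/
def ReLUNode.eval {m : ℕ} (v : ReLUNode m) (x : Fin m → ℚ) : ℚ :=
  max 0 (v.bias + ∑ i, v.weight i * x i)

/-- A ReLU layer: a tuple of `n` ReLU nodes with a common input dimension `m`. -/
abbrev ReLULayer (m n : ℕ) : Type := Fin n → ReLUNode m

/-- The function computed by a ReLU layer. -/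
def ReLULayer.eval {m n : ℕ} (l : ReLULayer m n) (x : Fin m → ℚ) : Fin n → ℚ :=
  fun i => (l i).eval x

/-- A ReLU neural network: a nonempty sequence of ReLU layers with matching dimensions. -/
inductive ReLUNet : ℕ → ℕ → Type
  | single {m n : ℕ} (l : ReLULayer m n) : ReLUNet m n
  | cons {m k n : ℕ} (l : ReLULayer m k) (rest : ReLUNet k n) : ReLUNet m n

/-- The function computed by a ReLU network; the first layer of the sequence is applied first. -/
def ReLUNet.eval : {m n : ℕ} → ReLUNet m n → (Fin m → ℚ) → (Fin n → ℚ)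
  | _, _, .single l, x => ReLULayer.eval l x
  | _, _, .cons l rest, x => rest.eval (ReLULayer.eval l x)

/-- An average hard attention layer with input dimension `d` and output dimension `e`:
affine query, key and value maps, and a ReLU network. -/
structure AHALayer (d e : ℕ) where
  /-- common dimension of keys and queries -/
  keyDim : ℕ
  /-- dimension of the value vectors -/
  valDim : ℕ
  query : (Fin d → ℚ) →ᵃ[ℚ] (Fin keyDim → ℚ)
  key : (Fin d → ℚ) →ᵃ[ℚ] (Fin keyDim → ℚ)
  value : (Fin d → ℚ) →ᵃ[ℚ] (Fin valDim → ℚ)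
  net : ReLUNet (d + valDim) e

namespace AHALayer

variable {d e n : ℕ}

/-- The set of positions `j` for which the score `⟨k i, q j⟩` is maximal. -/
def attended (l : AHALayer d e) (x : Fin n → Fin d → ℚ) (i : Fin n) : Finset (Fin n) :=
  {j | ∀ j', l.key (x i) ⬝ᵥ l.query (x j') ≤ l.key (x i) ⬝ᵥ l.query (x j)}

/-- The attention vector at position `i`: the average of the values at the attended positions. -/
def attention (l : AHALayer d e) (x : Fin n → Fin d → ℚ) (i : Fin n) : Fin l.valDim → ℚ :=
  ((l.attended x i).card : ℚ)⁻¹ • ∑ j ∈ l.attended x i, l.value (x j)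

/-- The function on sequences computed by the layer: `y i = N (x i, a i)`. -/
def eval (l : AHALayer d e) (x : Fin n → Fin d → ℚ) : Fin n → Fin e → ℚ :=
  fun i => l.net.eval (Fin.append (x i) (l.attention x i))

end AHALayer

/-- A finite sequence of AHA layers with matching dimensions. -/
inductive AHAStack : ℕ → ℕ → Type
  | nil {d : ℕ} : AHAStack d d
  | cons {d e f : ℕ} (l : AHALayer d e) (rest : AHAStack e f) : AHAStack d f

/-- The number of attention layers. -/
def AHAStack.length : {d f : ℕ} → AHAStack d f → ℕ
  | _, _, .nil => 0
  | _, _, .cons _ rest => rest.length + 1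

/-- The function on sequences computed by a stack; the first layer is applied first. -/
def AHAStack.eval {n : ℕ} : {d f : ℕ} → AHAStack d f → (Fin n → Fin d → ℚ) → (Fin n → Fin f → ℚ)
  | _, _, .nil, x => x
  | _, _, .cons l rest, x => rest.eval (l.eval x)

/-- An average hard attention transformer over the alphabet `A`. The output dimension is written
`outDim + 1` because acceptance reads the first output coordinate. -/
structure AHAT (A : Type) where
  inDim : ℕ
  outDim : ℕ
  embed : A → Fin inDim → ℚ
  /-- positional encoding `p n i`, for `n` the length of the word and `i` a position counted
  from `1` -/
  posEnc : ℕ → ℕ → Fin inDim → ℚ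
  layers : AHAStack inDim (outDim + 1)

namespace AHAT

variable {A : Type}

/-- The input sequence of vectors: `x i = embed (w i) + p (n, i)`. -/
def input (T : AHAT A) (w : List A) : Fin w.length → Fin T.inDim → ℚ :=
  fun i => T.embed (w.get i) + T.posEnc w.length (i + 1)

/-- The language of a transformer without end marker: the nonempty words for which the first
coordinate of the output vector at the last position is positive. -/
def language (T : AHAT A) : Language A :=
  {w | ∃ h : w ≠ [], 0 < T.layers.eval (T.input w)
    ⟨w.length - 1, Nat.sub_one_lt (mt List.length_eq_zero_iff.mp h)⟩ 0}

/-- The number of attention layers. -/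
def numLayers (T : AHAT A) : ℕ := T.layers.length

/-- No positional encoding: the positional encoding is a constant function. -/
def IsNoPE (T : AHAT A) : Prop := ∃ c, ∀ n i, T.posEnc n i = c

end AHAT

/-! ### Linear temporal logic with counting -/

mutual

/-- Formulas `φ ::= a | t ≤ t | ¬φ | φ ∨ φ | X φ | φ U φ` of `LTL[Count]`. -/
inductive LTLCount (A : Type) : Type
  | letter : A → LTLCount A
  | le : CountTerm A → CountTerm A → LTLCount A
  | neg : LTLCount A → LTLCount A
  | or : LTLCount A → LTLCount A → LTLCount A
  | next : LTLCount A → LTLCount A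
  | until : LTLCount A → LTLCount A → LTLCount A

/-- Terms `t ::= k | k · #←φ | k · #→φ | t + t` with integers `k`. -/
inductive CountTerm (A : Type) : Type
  | const : ℤ → CountTerm A
  | past : ℤ → LTLCount A → CountTerm A
  | future : ℤ → LTLCount A → CountTerm A
  | add : CountTerm A → CountTerm A → CountTerm A

end

open Classical in
mutual

/-- `φ.Sat w i`: the formula `φ` holds in the word `w` at position `i`; positions are counted
from `0`, so they range over `i < w.length`. -/
noncomputable def LTLCount.Sat {A : Type} (w : List A) : LTLCount A → ℕ → Prop
  | .letter a, i => w[i]? = some a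
  | .le s t, i => CountTerm.val w s i ≤ CountTerm.val w t i
  | .neg φ, i => ¬ LTLCount.Sat w φ i
  | .or φ ψ, i => LTLCount.Sat w φ i ∨ LTLCount.Sat w ψ i
  | .next φ, i => i + 1 < w.length ∧ LTLCount.Sat w φ (i + 1)
  | .until φ ψ, i => ∃ j, i ≤ j ∧ j < w.length ∧ LTLCount.Sat w ψ j ∧
      ∀ k, i ≤ k → k < j → LTLCount.Sat w φ k

/-- The value of a counting term at position `i`: `past` counts the positions strictly before `i`,
`future` counts the positions from `i` (inclusive) to the end of the word. -/
noncomputable def CountTerm.val {A : Type} (w : List A) : CountTerm A → ℕ → ℤ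
  | .const k, _ => k
  | .past k φ, i => k * (((Finset.range i).filter fun j => LTLCount.Sat w φ j).card : ℤ)
  | .future k φ, i => k * (((Finset.Ico i w.length).filter fun j => LTLCount.Sat w φ j).card : ℤ)
  | .add s t, i => CountTerm.val w s i + CountTerm.val w t i

end

/-- The language of a formula: the nonempty words satisfying it at their first position. -/
def LTLCount.language {A : Type} (φ : LTLCount A) : Language A :=
  {w | w ≠ [] ∧ φ.Sat w 0}

/-- Definability of a language in `LTL[Count]`. -/
def IsLTLCountDefinable {A : Type} (L : Language A) : Prop :=
  ∃ φ : LTLCount A, φ.language = L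

/-! ### Simplified multicounter machines -/

/-- The counter operations `+1`, `-1`, `·0` and `·1`. -/
inductive CounterOp : Type
  | incr
  | decr
  | reset
  | noop

/-- The effect of an operation on a counter. -/
def CounterOp.apply : CounterOp → ℤ → ℤ
  | .incr, x => x + 1
  | .decr, x => x - 1
  | .reset, _ => 0
  | .noop, x => x

/-- The masking function: `false` marks the zero entries, `true` the nonzero ones. -/
def mask {d : ℕ} (x : Fin d → ℤ) : Fin d → Bool := fun i => decide (x i ≠ 0)

/-- A `d`-dimensional simplified multicounter machine with input alphabet `A` and state set `Q`
(finiteness of `Q` is required in `IsSMCMLanguage`). -/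
structure SMCM (A Q : Type) (d : ℕ) where
  start : Q
  trans : Q → A → (Fin d → Bool) → Q
  update : A → Fin d → CounterOp
  accepting : Set (Q × (Fin d → Bool))

namespace SMCM

variable {A Q : Type} {d : ℕ}

/-- The unique configuration reached from a configuration by reading one letter. -/
def step (M : SMCM A Q d) (c : Q × (Fin d → ℤ)) (a : A) : Q × (Fin d → ℤ) :=
  (M.trans c.1 a (mask c.2), fun i => (M.update a i).apply (c.2 i))

/-- The configuration reached from the start state and zero counters by reading a word. -/
def run (M : SMCM A Q d) (w : List A) : Q × (Fin d → ℤ) :=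
  w.foldl M.step (M.start, 0)

/-- The set of accepted words. -/
def language (M : SMCM A Q d) : Language A :=
  {w | ((M.run w).1, mask (M.run w).2) ∈ M.accepting}

end SMCM

/-- Acceptance of a language by some simplified multicounter machine. -/
def IsSMCMLanguage {A : Type} (L : Language A) : Prop :=
  ∃ (Q : Type) (_ : Finite Q) (d : ℕ) (M : SMCM A Q d), M.language = L

/-! ### Parikh images and the language `SQRT` -/

/-- The Parikh vector of a word: its number of occurrences of each letter. -/
def parikh {A : Type} [DecidableEq A] (w : List A) : A → ℕ := fun c => w.count c

/-- The Parikh image of a language. -/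
def parikhImage {A : Type} [DecidableEq A] (L : Language A) : Set (A → ℕ) :=
  {v | ∃ w ∈ L, parikh w = v}

/-- The two-letter alphabet. -/
inductive Letter : Type
  | a
  | b
  deriving DecidableEq

/-- `SQRT = {w ∈ {a, b}* : |w|_a < |w| / √2}`. -/
def SQRT : Language Letter :=
  {w | (w.count Letter.a : ℝ) < (w.length : ℝ) / Real.sqrt 2}

end CountLang

/-!
Membership in `SQRT` says that the linear form `|w| - √2 |w|_a` is positive, that is, that
`1 - 2 α ^ 2` is positive, where `α` is the frequency of the letter `a`.

* Two layers of uniform attention compute `α ^ 2`: averaging the indicator of `a` yields `α`, and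
  averaging its product with `α`, which a ReLU node computes as `max (0, x + α - 1)` for
  `x ∈ {0, 1}`, yields `α ^ 2`.
* A linear form which is bounded below on a semilinear set attains its minimum there, namely at one
  of the base points. But the form above takes arbitrarily small positive values, as multiplication
  by the unit `3 - 2√2 < 1` of `ℤ[√2]` preserves its values on `ℕ × ℕ`. So the Parikh image is not
  semilinear.
* Along the words `a ^ k b ^ m` the truth value of an `LTL[Count]` formula changes boundedly often,
  because a counting term is piecewise affine in the position with boundedly many pieces, and the
  sets of triples `(k, m, i)` such that the formula holds at the position `i` of `a ^ k b ^ m` are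
  semilinear. Hence each definable language yields a semilinear set of pairs `(k, m)`.
* A counter of a simplified multicounter machine that differs from zero after `a ^ k` cannot be
  counted back to zero by fewer than `k` letters `b`. So the machine does not distinguish
  `a ^ k b ^ m` from `a ^ k' b ^ m` if `m < k, k'` and its states after `a ^ k` and `a ^ k'` agree.
  By the pigeonhole principle these states agree for some `k` and some `k'` much larger than `k`.
-/

open scoped Pointwise

namespace CountLang

/-! ### Semilinear maps -/

section SemilinearMap

variable {X Y Z : Type*} [AddCommMonoid X] [AddCommMonoid Y] [AddCommMonoid Z]

/-- Maps with a semilinear graph. They are closed under composition, and preimages of semilinear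
sets under them are semilinear, which reduces the bookkeeping of variables in semilinear sets to
`fun_prop`. -/
@[fun_prop]
def IsSemilinearMap (f : X → Y) : Prop :=
  IsSemilinearSet {q : X × Y | f q.1 = q.2}

section SetOfPred

variable {p q : X → Prop}

lemma isSemilinearSet_setOfPred_and (hp : IsSemilinearSet {x | p x})
    (hq : IsSemilinearSet {x | q x}) : IsSemilinearSet {x | p x ∧ q x} :=
  hp.inter hq

lemma isSemilinearSet_setOfPred_or (hp : IsSemilinearSet {x | p x})
    (hq : IsSemilinearSet {x | q x}) : IsSemilinearSet {x | p x ∨ q x} :=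
  hp.union hq

lemma isSemilinearSet_setOfPred_not [AddMonoid.FG X] (hp : IsSemilinearSet {x | p x}) :
    IsSemilinearSet {x | ¬p x} :=
  hp.compl

lemma isSemilinearSet_setOfPred_imp [AddMonoid.FG X] (hp : IsSemilinearSet {x | p x})
    (hq : IsSemilinearSet {x | q x}) : IsSemilinearSet {x | p x → q x} := by
  simpa only [imp_iff_not_or] using
    isSemilinearSet_setOfPred_or (isSemilinearSet_setOfPred_not hp) hq

lemma isSemilinearSet_setOfPred_exists {r : X → Y → Prop}
    (hr : IsSemilinearSet {q : X × Y | r q.1 q.2}) : IsSemilinearSet {x | ∃ y, r x y} := by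
  convert hr.image (AddMonoidHom.fst X Y)
  ext x
  simp

lemma isSemilinearSet_setOfPred_forall [AddMonoid.FG X] [AddMonoid.FG Y] {r : X → Y → Prop}
    (hr : IsSemilinearSet {q : X × Y | r q.1 q.2}) : IsSemilinearSet {x | ∀ y, r x y} := by
  simpa only [not_exists_not] using isSemilinearSet_setOfPred_not
    (isSemilinearSet_setOfPred_exists (r := fun x y ↦ ¬r x y) (isSemilinearSet_setOfPred_not hr))

end SetOfPred

namespace IsSemilinearMap

lemma of_addMonoidHom [AddMonoid.FG X] (f : X →+ Y) : IsSemilinearMap f := by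
  have graph_eq : {q : X × Y | f q.1 = q.2} = (AddMonoidHom.id X).prod f '' Set.univ := by
    ext ⟨x, y⟩
    simp
  simpa only [IsSemilinearMap, graph_eq] using IsSemilinearSet.univ.image _

@[fun_prop]
lemma id [AddMonoid.FG X] : IsSemilinearMap fun x : X ↦ x :=
  of_addMonoidHom (.id X)

@[fun_prop]
lemma const [AddMonoid.FG X] (y : Y) : IsSemilinearMap fun _ : X ↦ y := by
  have graph_eq : {q : X × Y | y = q.2} =
      ((0, y) : X × Y) +ᵥ AddMonoidHom.inl X Y '' Set.univ := by
    ext ⟨x, z⟩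
    simp [Set.mem_vadd_set]
  simpa only [IsSemilinearMap, graph_eq] using (IsSemilinearSet.univ.image _).vadd _

variable [AddMonoid.FG X] [AddMonoid.FG Y]

lemma preimage {f : X → Y} (hf : IsSemilinearMap f) {p : Y → Prop}
    (hp : IsSemilinearSet {y | p y}) : IsSemilinearSet {x | p (f x)} := by
  have hp' : IsSemilinearSet {q : X × Y | p q.2} := hp.preimage (AddMonoidHom.snd X Y)
  simpa using isSemilinearSet_setOfPred_exists (r := fun x y ↦ f x = y ∧ p y)
    (isSemilinearSet_setOfPred_and hf hp')

variable [AddMonoid.FG Z]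

@[fun_prop]
lemma prodMk {f : X → Y} {g : X → Z} (hf : IsSemilinearMap f) (hg : IsSemilinearMap g) :
    IsSemilinearMap fun x ↦ (f x, g x) := by
  have hf' : IsSemilinearSet {q : X × Y × Z | f q.1 = q.2.1} :=
    IsSemilinearSet.preimage hf ((AddMonoidHom.id X).prodMap (.fst Y Z))
  have hg' : IsSemilinearSet {q : X × Y × Z | g q.1 = q.2.2} :=
    IsSemilinearSet.preimage hg ((AddMonoidHom.id X).prodMap (.snd Y Z))
  simpa only [IsSemilinearMap, Prod.ext_iff] using isSemilinearSet_setOfPred_and hf' hg'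

@[fun_prop]
lemma comp {g : Y → Z} {f : X → Y} (hg : IsSemilinearMap g) (hf : IsSemilinearMap f) :
    IsSemilinearMap fun x ↦ g (f x) := by
  have hf' : IsSemilinearMap fun q : X × Z ↦ f q.1 :=
    IsSemilinearSet.preimage hf ((AddMonoidHom.fst X Z).prodMap (.id Y))
  exact (hf'.prodMk (of_addMonoidHom (.snd X Z))).preimage hg

@[fun_prop]
lemma fst {f : X → Y × Z} (hf : IsSemilinearMap f) : IsSemilinearMap fun x ↦ (f x).1 :=
  (of_addMonoidHom (.fst Y Z)).comp hf

@[fun_prop]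
lemma snd {f : X → Y × Z} (hf : IsSemilinearMap f) : IsSemilinearMap fun x ↦ (f x).2 :=
  (of_addMonoidHom (.snd Y Z)).comp hf

@[fun_prop]
lemma add {f g : X → Y} (hf : IsSemilinearMap f) (hg : IsSemilinearMap g) :
    IsSemilinearMap fun x ↦ f x + g x :=
  (of_addMonoidHom ((AddMonoidHom.id Y).coprod (.id Y))).comp (hf.prodMk hg)

@[fun_prop]
lemma natCast {R : Type*} [NonAssocSemiring R] [AddMonoid.FG R] {f : X → ℕ}
    (hf : IsSemilinearMap f) : IsSemilinearMap fun x ↦ (f x : R) :=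
  (of_addMonoidHom (Nat.castAddMonoidHom R)).comp hf

@[fun_prop]
lemma const_mul {R : Type*} [NonUnitalNonAssocSemiring R] [AddMonoid.FG R] {f : X → R} (c : R)
    (hf : IsSemilinearMap f) : IsSemilinearMap fun x ↦ c * f x :=
  (of_addMonoidHom (AddMonoidHom.mulLeft c)).comp hf

@[fun_prop]
lemma sub {G : Type*} [AddCommGroup G] [AddMonoid.FG G] {f g : X → G} (hf : IsSemilinearMap f)
    (hg : IsSemilinearMap g) : IsSemilinearMap fun x ↦ f x - g x := by
  have hg' : IsSemilinearMap fun x ↦ -g x := (of_addMonoidHom negAddMonoidHom).comp hg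
  simpa only [sub_eq_add_neg] using hf.add hg'

lemma setOfPred_eq {f g : X → Y} (hf : IsSemilinearMap f) (hg : IsSemilinearMap g) :
    IsSemilinearSet {x | f x = g x} :=
  (IsSemilinearMap.id.prodMk hg).preimage hf

lemma setOfPred_le [LE Y] [CanonicallyOrderedAdd Y] {f g : X → Y} (hf : IsSemilinearMap f)
    (hg : IsSemilinearMap g) : IsSemilinearSet {x | f x ≤ g x} := by
  simp only [le_iff_exists_add]
  exact isSemilinearSet_setOfPred_exists (setOfPred_eq (by fun_prop) (by fun_prop))

lemma setOfPred_lt {f g : X → ℕ} (hf : IsSemilinearMap f) (hg : IsSemilinearMap g) :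
    IsSemilinearSet {x | f x < g x} := by
  simpa only [Nat.lt_iff_add_one_le] using setOfPred_le (hf.add (const 1)) hg

lemma setOfPred_nonneg {f : X → ℤ} (hf : IsSemilinearMap f) : IsSemilinearSet {x | 0 ≤ f x} := by
  have nonneg_iff (z : ℤ) : 0 ≤ z ↔ ∃ n : ℕ, z = n := ⟨Int.eq_ofNat_of_zero_le, by lia⟩
  simp only [nonneg_iff]
  exact isSemilinearSet_setOfPred_exists (setOfPred_eq (by fun_prop) (by fun_prop))

end IsSemilinearMap

end SemilinearMap

/-! ### Linear forms on semilinear sets -/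

lemma exists_forall_map_le_of_isLinearSet {M R : Type*} [AddCommMonoid M] [AddCommGroup R]
    [LinearOrder R] [IsOrderedAddMonoid R] [Archimedean R] {s : Set M} (hs : IsLinearSet s)
    (f : M →+ R) (hf : BddBelow (f '' s)) : ∃ v ∈ s, ∀ x ∈ s, f v ≤ f x := by
  obtain ⟨v, t, -, rfl⟩ := hs
  obtain ⟨c, hc⟩ := hf
  refine ⟨v, Set.mem_vadd_set.2 ⟨0, zero_mem _, add_zero v⟩, ?_⟩
  rintro _ ⟨p, hp, rfl⟩
  suffices 0 ≤ f p by simpa using this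
  by_contra! hneg
  obtain ⟨n, hn⟩ := Archimedean.arch (f v - c) (neg_pos.2 hneg)
  have mem : v + (n + 1) • p ∈ v +ᵥ (AddSubmonoid.closure t : Set M) :=
    Set.mem_vadd_set.2 ⟨_, nsmul_mem hp _, rfl⟩
  have lower : c ≤ f v + (n + 1) • f p := by simpa using hc (Set.mem_image_of_mem f mem)
  rw [succ_nsmul] at lower
  have : n • f p ≤ - (f v - c) := by simpa using neg_le_neg hn
  grind

lemma exists_forall_map_le_of_isSemilinearSet {M R : Type*} [AddCommMonoid M] [AddCommGroup R]
    [LinearOrder R] [IsOrderedAddMonoid R] [Archimedean R] {s : Set M} (hs : IsSemilinearSet s)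
    (hne : s.Nonempty) (f : M →+ R) (hf : BddBelow (f '' s)) : ∃ v ∈ s, ∀ x ∈ s, f v ≤ f x := by
  obtain ⟨S, hS, hlin, rfl⟩ := hs
  obtain ⟨-, t₀, ht₀, -⟩ := hne
  have exists_min (t : Set M) (ht : t ∈ S) : ∃ v ∈ t, ∀ x ∈ t, f v ≤ f x :=
    exists_forall_map_le_of_isLinearSet (hlin t ht) f
      (hf.mono (Set.image_mono (Set.subset_sUnion_of_mem ht)))
  choose! v mem_t hmin using exists_min
  obtain ⟨t, ht, hv⟩ := S.exists_min_image (fun t ↦ f (v t)) hS ⟨t₀, ht₀⟩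
  refine ⟨v t, ⟨t, ht, mem_t t ht⟩, ?_⟩
  rintro x ⟨u, hu, hx⟩
  exact (hv u hu).trans (hmin u hu x hx)

/-- The linear form `|w| - √2 |w|_a` as a function of `(|w|_a, |w|_b)`: membership in `SQRT` means
that it is positive. -/
noncomputable def gap : ℕ × ℕ →+ ℝ where
  toFun p := (p.1 + p.2) - √2 * p.1
  map_zero' := by simp
  map_add' p q := by push_cast [Prod.fst_add, Prod.snd_add]; ring

lemma gap_pos_iff (p : ℕ × ℕ) : 0 < gap p ↔ 2 * p.1 ^ 2 < (p.1 + p.2) ^ 2 := by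
  have sqrt_mul_sq : (√2 * p.1) ^ 2 = 2 * (p.1 : ℝ) ^ 2 := by simp [mul_pow]
  rw [show gap p = (p.1 + p.2) - √2 * p.1 from rfl, sub_pos,
    ← pow_lt_pow_iff_left₀ (by positivity) (by positivity) two_ne_zero, sqrt_mul_sq]
  exact_mod_cast Iff.rfl

-- Multiplication by the unit `3 - 2√2` of `ℤ[√2]` is given by natural number coefficients.
lemma gap_pell (k m : ℕ) : gap (5 * k + 2 * m, 2 * k + m) = (3 - 2 * √2) * gap (k, m) := by
  change ((5 * k + 2 * m : ℕ) + (2 * k + m : ℕ) - √2 * (5 * k + 2 * m : ℕ) : ℝ) =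
    (3 - 2 * √2) * (k + m - √2 * k)
  push_cast
  linear_combination -2 * (k : ℝ) * Real.sq_sqrt (zero_le_two (α := ℝ))

theorem not_isSemilinearSet_two_mul_sq_lt :
    ¬IsSemilinearSet {p : ℕ × ℕ | 2 * p.1 ^ 2 < (p.1 + p.2) ^ 2} := by
  intro h
  simp only [← gap_pos_iff] at h
  have bdd : BddBelow (gap '' {p | 0 < gap p}) :=
    ⟨0, Set.forall_mem_image.2 fun _ hp ↦ le_of_lt hp⟩
  have nonempty : (0, 1) ∈ {p | 0 < gap p} := by simp [gap_pos_iff]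
  obtain ⟨⟨k, m⟩, hpos : 0 < gap (k, m), hmin⟩ :=
    exists_forall_map_le_of_isSemilinearSet h ⟨_, nonempty⟩ gap bdd
  have lt_sqrt : 1 < √2 := Real.lt_sqrt_of_sq_lt (by norm_num)
  have sqrt_lt : √2 < 3 / 2 := (Real.sqrt_lt' (by norm_num)).2 (by norm_num)
  have pell_pos : 0 < gap (5 * k + 2 * m, 2 * k + m) := by
    rw [gap_pell]; exact mul_pos (by linarith) hpos
  have pell_lt : gap (5 * k + 2 * m, 2 * k + m) < gap (k, m) := by
    rw [gap_pell]; exact mul_lt_of_lt_one_left hpos (by linarith)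
  exact (hmin _ pell_pos).not_gt pell_lt

/-! ### Predicates with boundedly many changes -/

section BoundedlyOften

variable {M : Type*} {B B' : M → ℕ → Prop}

/-- A family of predicates on positions each of which holds at no more than `C` positions, for one
bound `C` for the whole family. -/
def BoundedlyOften (B : M → ℕ → Prop) : Prop :=
  ∃ C, ∀ x [DecidablePred (B x)] n, Nat.count (B x) n ≤ C

lemma count_or_le (p q : ℕ → Prop) [DecidablePred p] [DecidablePred q]
    [DecidablePred fun i ↦ p i ∨ q i] (n : ℕ) :
    Nat.count (fun i ↦ p i ∨ q i) n ≤ Nat.count p n + Nat.count q n := by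
  induction n with
  | zero => simp
  | succ n ih => grind

namespace BoundedlyOften

lemma mono (hB : BoundedlyOften B) (h : ∀ x i, B' x i → B x i) : BoundedlyOften B' := by
  classical
  obtain ⟨C, hC⟩ := hB
  exact ⟨C, fun x _ n ↦ (Nat.count_mono_left fun i _ ↦ h x i).trans (hC x n)⟩

lemma or (hB : BoundedlyOften B) (hB' : BoundedlyOften B') :
    BoundedlyOften fun x i ↦ B x i ∨ B' x i := by
  classical
  obtain ⟨C, hC⟩ := hB
  obtain ⟨C', hC'⟩ := hB'
  exact ⟨C + C', fun x _ n ↦ (count_or_le _ _ n).trans (add_le_add (hC x n) (hC' x n))⟩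

lemma shift (hB : BoundedlyOften B) : BoundedlyOften fun x i ↦ B x (i + 1) := by
  classical
  obtain ⟨C, hC⟩ := hB
  refine ⟨C, fun x _ n ↦ Nat.le_trans ?_ (hC x (n + 1))⟩
  rw [Nat.count_succ']
  convert Nat.le_add_right _ _

lemma of_forall_not (h : ∀ x i, ¬B x i) : BoundedlyOften B :=
  ⟨0, fun x _ _ ↦ (Nat.count_iff_forall_not.2 fun i _ ↦ h x i).le⟩

lemma of_forall_eq (e : M → ℕ) (h : ∀ x i, B x i → i = e x) : BoundedlyOften B := by
  refine ⟨1, fun x _ _ ↦ ?_⟩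
  rw [Nat.count_eq_card_filter_range]
  exact Finset.card_le_one.2 (by grind)

end BoundedlyOften

end BoundedlyOften

/-- `S` changes its truth value between the positions `i` and `i + 1`. -/
def Flips (S : ℕ → Prop) (i : ℕ) : Prop :=
  ¬(S i ↔ S (i + 1))

/-- The slope of `f` changes at the position `i + 1`. -/
def Bends (f : ℕ → ℤ) (i : ℕ) : Prop :=
  f (i + 2) - f (i + 1) ≠ f (i + 1) - f i

lemma exists_last_flip {S : ℕ → Prop} [DecidablePred (Flips S)] {n r : ℕ}
    (h : Nat.count (Flips S) n ≤ r) :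
    ∃ i ≤ n, (i = 0 ∨ Nat.count (Flips S) (i - 1) < r) ∧ ∀ k, i ≤ k → k < n → ¬Flips S k := by
  induction n with
  | zero => exact ⟨0, by lia⟩
  | succ n ih =>
    by_cases hn : Flips S n
    · exact ⟨n + 1, by grind⟩
    · obtain ⟨i, hi⟩ := ih (by grind)
      exact ⟨i, by grind⟩

lemma iff_of_forall_not_flips {S : ℕ → Prop} {i j : ℕ} (hij : i ≤ j)
    (h : ∀ k, i ≤ k → k < j → ¬Flips S k) : S i ↔ S j := by
  induction j, hij using Nat.le_induction with
  | base => rfl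
  | succ j hij ih => grind [Flips]

-- The last summand vanishes while `f` moves towards a change of sign; otherwise `f` has to bend
-- before its sign changes.
open Classical in
lemma count_flips_nonneg_le (f : ℕ → ℤ) (n : ℕ) :
    Nat.count (Flips fun i ↦ 0 ≤ f i) n ≤ Nat.count (Bends f) n +
      if (f n < 0 ∧ f n < f (n + 1)) ∨ (0 ≤ f n ∧ f (n + 1) < f n) then 0 else 1 := by
  induction n with
  | zero => simp
  | succ n ih =>
    simp only [Nat.count_succ, Flips, Bends] at ih ⊢
    grind

lemma count_add_of_forall (p : ℕ → Prop) [DecidablePred p] {i d : ℕ} (h : ∀ k < d, p (i + k)) :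
    Nat.count p (i + d) = Nat.count p i + d := by
  rw [Nat.count_add, Nat.count_iff_forall.2 h]

lemma count_add_of_forall_not (p : ℕ → Prop) [DecidablePred p] {i d : ℕ}
    (h : ∀ k < d, ¬p (i + k)) : Nat.count p (i + d) = Nat.count p i := by
  rw [Nat.count_add, Nat.count_iff_forall_not.2 h, add_zero]

lemma card_filter_Ico_eq_count_sub_count (p : ℕ → Prop) [DecidablePred p] (i n : ℕ) :
    (((Finset.Ico i n).filter p).card : ℤ) =
      Nat.count (fun j ↦ p j ∧ j < n) n - Nat.count (fun j ↦ p j ∧ j < n) i := by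
  rw [eq_sub_iff_add_eq]
  norm_cast
  have disj : Disjoint ((Finset.Ico i n).filter p) ((Finset.range i).filter fun j ↦ p j ∧ j < n) :=
    Finset.disjoint_left.2 (by grind)
  rw [Nat.count_eq_card_filter_range, Nat.count_eq_card_filter_range,
    ← Finset.card_union_of_disjoint disj]
  congr 1
  ext j
  grind

/-- The pairs `(i, c)` where `c` is the number of elements of `S` below `i`, as far as this number
can be computed by splitting the positions below `i` into `r` intervals on each of which `S` is
constant. -/
def CountGraph (S : ℕ → Prop) : ℕ → ℕ → ℕ → Prop
  | 0, i, c => i = 0 ∧ c = 0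
  | r + 1, i, c => ∃ i' c', i' ≤ i ∧ CountGraph S r i' c' ∧
      ((∀ k, i' ≤ k → k < i → S k) ∧ c + i' = c' + i ∨
        (∀ k, i' ≤ k → k < i → ¬S k) ∧ c = c')

lemma CountGraph.count_eq {S : ℕ → Prop} [DecidablePred S] {r i c : ℕ} (h : CountGraph S r i c) :
    Nat.count S i = c := by
  induction r generalizing i c with
  | zero => simp [h.1, h.2]
  | succ r ih =>
    obtain ⟨i', c', hle, h', hconst⟩ := h
    obtain ⟨d, rfl⟩ := Nat.exists_eq_add_of_le hle
    rcases hconst with ⟨hS, hc⟩ | ⟨hS, hc⟩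
    · grind [count_add_of_forall S (i := i') (d := d) (by grind)]
    · grind [count_add_of_forall_not S (i := i') (d := d) (by grind)]

lemma countGraph_count {S : ℕ → Prop} [DecidablePred S] [DecidablePred (Flips S)] {r i : ℕ}
    (h : i = 0 ∨ Nat.count (Flips S) (i - 1) < r) : CountGraph S r i (Nat.count S i) := by
  induction r generalizing i with
  | zero => simp_all [CountGraph]
  | succ r ih =>
    obtain ⟨i', hle, hi', hconst⟩ : ∃ i' ≤ i, (i' = 0 ∨ Nat.count (Flips S) (i' - 1) < r) ∧
        ((∀ k, i' ≤ k → k < i → S k) ∨ ∀ k, i' ≤ k → k < i → ¬S k) := by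
      rcases i.eq_zero_or_pos with rfl | hpos
      · exact ⟨0, by simp⟩
      · obtain ⟨i', hle, hi', hflips⟩ := exists_last_flip (S := S) (n := i - 1) (r := r) (by grind)
        have iff_start (k) (hk : i' ≤ k) (hki : k < i) : S i' ↔ S k :=
          iff_of_forall_not_flips hk fun j hj hjk ↦ hflips j hj (by lia)
        exact ⟨i', by grind⟩
    obtain ⟨d, rfl⟩ := Nat.exists_eq_add_of_le hle
    refine ⟨i', _, hle, ih hi', ?_⟩
    rcases hconst with hS | hS
    · grind [count_add_of_forall S (i := i') (d := d) (by grind)]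
    · grind [count_add_of_forall_not S (i := i') (d := d) (by grind)]

section IsTame

variable {M : Type*} [AddCommMonoid M]

/-- A semilinear family of predicates on the positions which flip boundedly often. These are the
properties of positions that an `LTL[Count]` formula can express along a semilinear family of words
whose letters form boundedly many blocks. -/
structure IsTame (S : M → ℕ → Prop) : Prop where
  isSemilinearSet : IsSemilinearSet {q : M × ℕ | S q.1 q.2}
  boundedlyOften_flips : BoundedlyOften fun x ↦ Flips (S x)

/-- The analogue of `IsTame` for integer valued functions of the position: they are piecewise
affine with boundedly many pieces. -/
structure IsTameFun (f : M → ℕ → ℤ) : Prop where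
  isSemilinearMap : IsSemilinearMap fun q : M × ℕ ↦ f q.1 q.2
  boundedlyOften_bends : BoundedlyOften fun x ↦ Bends (f x)

variable {S T : M → ℕ → Prop}

namespace IsTame

lemma or (hS : IsTame S) (hT : IsTame T) : IsTame fun x i ↦ S x i ∨ T x i where
  isSemilinearSet := isSemilinearSet_setOfPred_or hS.isSemilinearSet hT.isSemilinearSet
  boundedlyOften_flips :=
    (hS.boundedlyOften_flips.or hT.boundedlyOften_flips).mono (by grind [Flips])

lemma and (hS : IsTame S) (hT : IsTame T) : IsTame fun x i ↦ S x i ∧ T x i where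
  isSemilinearSet := isSemilinearSet_setOfPred_and hS.isSemilinearSet hT.isSemilinearSet
  boundedlyOften_flips :=
    (hS.boundedlyOften_flips.or hT.boundedlyOften_flips).mono (by grind [Flips])

variable [AddMonoid.FG M]

lemma of_forall_iff {p : M → Prop} (hp : IsSemilinearSet {x | p x}) : IsTame fun x _ ↦ p x where
  isSemilinearSet := IsSemilinearMap.preimage (f := Prod.fst) (by fun_prop) hp
  boundedlyOften_flips := .of_forall_not (by simp [Flips])

lemma lt {e : M → ℕ} (he : IsSemilinearMap e) : IsTame fun x i ↦ i < e x where
  isSemilinearSet := IsSemilinearMap.setOfPred_lt (by fun_prop) (by fun_prop)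
  boundedlyOften_flips := .of_forall_eq (fun x ↦ e x - 1) (by grind [Flips])

lemma not (hS : IsTame S) : IsTame fun x i ↦ ¬S x i where
  isSemilinearSet := isSemilinearSet_setOfPred_not hS.isSemilinearSet
  boundedlyOften_flips := hS.boundedlyOften_flips.mono (by grind [Flips])

lemma shift (hS : IsTame S) : IsTame fun x i ↦ S x (i + 1) where
  isSemilinearSet := IsSemilinearMap.preimage (f := fun q : M × ℕ ↦ (q.1, q.2 + 1)) (by fun_prop)
    hS.isSemilinearSet
  boundedlyOften_flips := hS.boundedlyOften_flips.shift

lemma isSemilinearSet_setOfPred_forall (hS : IsTame S) :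
    IsSemilinearSet {q : (M × ℕ) × ℕ | ∀ k, q.1.2 ≤ k → k < q.2 → S q.1.1 k} := by
  refine CountLang.isSemilinearSet_setOfPred_forall <|
    isSemilinearSet_setOfPred_imp (IsSemilinearMap.setOfPred_le (by fun_prop) (by fun_prop)) <|
    isSemilinearSet_setOfPred_imp (IsSemilinearMap.setOfPred_lt (by fun_prop) (by fun_prop)) ?_
  exact IsSemilinearMap.preimage (f := fun q : ((M × ℕ) × ℕ) × ℕ ↦ (q.1.1.1, q.2)) (by fun_prop)
    hS.isSemilinearSet

lemma strongUntil (hS : IsTame S) (hT : IsTame T) :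
    IsTame fun x i ↦ ∃ j, i ≤ j ∧ T x j ∧ ∀ k, i ≤ k → k < j → S x k where
  isSemilinearSet := by
    refine isSemilinearSet_setOfPred_exists <|
      isSemilinearSet_setOfPred_and (IsSemilinearMap.setOfPred_le (by fun_prop) (by fun_prop)) <|
      isSemilinearSet_setOfPred_and ?_ hS.isSemilinearSet_setOfPred_forall
    exact IsSemilinearMap.preimage (f := fun q : (M × ℕ) × ℕ ↦ (q.1.1, q.2)) (by fun_prop)
      hT.isSemilinearSet
  boundedlyOften_flips := by
    refine (hS.boundedlyOften_flips.or hT.boundedlyOften_flips).mono fun x i hflip ↦ ?_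
    set U : ℕ → Prop := fun i ↦ ∃ j, i ≤ j ∧ T x j ∧ ∀ k, i ≤ k → k < j → S x k
    have until_unfold (i : ℕ) : U i ↔ T x i ∨ S x i ∧ U (i + 1) := by
      constructor
      · rintro ⟨j, hij, hT, hS⟩
        grind
      · rintro (hT | ⟨hS, j, hij, hT, hS'⟩)
        · exact ⟨i, by grind⟩
        · exact ⟨j, by grind⟩
    grind [Flips, until_unfold i, until_unfold (i + 1)]

end IsTame

variable [AddMonoid.FG M]

lemma IsTame.isSemilinearSet_countGraph (hS : IsTame S) (r : ℕ) :
    IsSemilinearSet {q : (M × ℕ) × ℕ | CountGraph (S q.1.1) r q.1.2 q.2} := by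
  induction r with
  | zero =>
    exact isSemilinearSet_setOfPred_and (IsSemilinearMap.setOfPred_eq (by fun_prop) (by fun_prop))
      (IsSemilinearMap.setOfPred_eq (by fun_prop) (by fun_prop))
  | succ r ih =>
    have reindex {p : (M × ℕ) × ℕ → Prop} (hp : IsSemilinearSet {q | p q}) :
        IsSemilinearSet {q : (((M × ℕ) × ℕ) × ℕ) × ℕ | p ((q.1.1.1.1, q.1.2), q.1.1.1.2)} :=
      IsSemilinearMap.preimage (by fun_prop) hp
    refine isSemilinearSet_setOfPred_exists <| isSemilinearSet_setOfPred_exists <|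
      isSemilinearSet_setOfPred_and (IsSemilinearMap.setOfPred_le (by fun_prop) (by fun_prop)) <|
      isSemilinearSet_setOfPred_and ?_ <|
      isSemilinearSet_setOfPred_or
        (isSemilinearSet_setOfPred_and (reindex hS.isSemilinearSet_setOfPred_forall) <|
          IsSemilinearMap.setOfPred_eq (by fun_prop) (by fun_prop))
        (isSemilinearSet_setOfPred_and (reindex hS.not.isSemilinearSet_setOfPred_forall) <|
          IsSemilinearMap.setOfPred_eq (by fun_prop) (by fun_prop))
    exact IsSemilinearMap.preimage
      (f := fun q : (((M × ℕ) × ℕ) × ℕ) × ℕ ↦ ((q.1.1.1.1, q.1.2), q.2)) (by fun_prop) ih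

theorem IsTame.isSemilinearMap_count [∀ x, DecidablePred (S x)] (hS : IsTame S) :
    IsSemilinearMap fun q : M × ℕ ↦ Nat.count (S q.1) q.2 := by
  classical
  obtain ⟨C, hC⟩ := hS.boundedlyOften_flips
  have countGraph_iff (q : (M × ℕ) × ℕ) :
      CountGraph (S q.1.1) (C + 1) q.1.2 q.2 ↔ Nat.count (S q.1.1) q.1.2 = q.2 :=
    ⟨CountGraph.count_eq, fun h ↦ h ▸ countGraph_count (.inr (Nat.lt_succ_of_le (hC _ _)))⟩
  simpa only [IsSemilinearMap, countGraph_iff] using hS.isSemilinearSet_countGraph (C + 1)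

namespace IsTameFun

variable {f g : M → ℕ → ℤ}

lemma of_isSemilinearMap {e : M → ℤ} (he : IsSemilinearMap e) : IsTameFun fun x _ ↦ e x where
  isSemilinearMap := by fun_prop
  boundedlyOften_bends := .of_forall_not (by simp [Bends])

lemma add (hf : IsTameFun f) (hg : IsTameFun g) : IsTameFun fun x i ↦ f x i + g x i where
  isSemilinearMap := hf.isSemilinearMap.add hg.isSemilinearMap
  boundedlyOften_bends :=
    (hf.boundedlyOften_bends.or hg.boundedlyOften_bends).mono (by grind [Bends])

lemma const_mul (c : ℤ) (hf : IsTameFun f) : IsTameFun fun x i ↦ c * f x i where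
  isSemilinearMap := hf.isSemilinearMap.const_mul c
  boundedlyOften_bends := hf.boundedlyOften_bends.mono (by grind [Bends])

lemma sub (hf : IsTameFun f) (hg : IsTameFun g) : IsTameFun fun x i ↦ f x i - g x i := by
  simpa only [neg_one_mul, ← sub_eq_add_neg] using hf.add (hg.const_mul (-1))

lemma count [∀ x, DecidablePred (S x)] (hS : IsTame S) :
    IsTameFun fun x i ↦ (Nat.count (S x) i : ℤ) where
  isSemilinearMap := hS.isSemilinearMap_count.natCast
  boundedlyOften_bends := hS.boundedlyOften_flips.mono (by grind [Bends, Flips])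

lemma isTame_nonneg (hf : IsTameFun f) : IsTame fun x i ↦ 0 ≤ f x i where
  isSemilinearSet := IsSemilinearMap.setOfPred_nonneg hf.isSemilinearMap
  boundedlyOften_flips := by
    classical
    obtain ⟨C, hC⟩ := hf.boundedlyOften_bends
    refine ⟨C + 1, fun x _ n ↦ ?_⟩
    have := count_flips_nonneg_le (f x) n
    have := hC x n
    grind

lemma isTame_le (hf : IsTameFun f) (hg : IsTameFun g) : IsTame fun x i ↦ f x i ≤ g x i := by
  simpa only [sub_nonneg] using (hg.sub hf).isTame_nonneg

end IsTameFun

/-- A semilinear family of words in which each letter occupies boundedly many intervals of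
positions. -/
structure IsTameFamily {A : Type*} (w : M → List A) : Prop where
  isSemilinearMap_length : IsSemilinearMap fun x ↦ (w x).length
  isTame_letter (a : A) : IsTame fun x i ↦ (w x)[i]? = some a

section Sat

variable {A : Type} {w : M → List A}

mutual

lemma LTLCount.isTame_sat (hw : IsTameFamily w) :
    ∀ φ : LTLCount A, IsTame fun x i ↦ φ.Sat (w x) i
  | .letter a => by simpa only [LTLCount.Sat] using hw.isTame_letter a
  | .le s t => by
    simpa only [LTLCount.Sat] using (s.isTameFun_val hw).isTame_le (t.isTameFun_val hw)
  | .neg φ => by simpa only [LTLCount.Sat] using (φ.isTame_sat hw).not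
  | .or φ ψ => by simpa only [LTLCount.Sat] using (φ.isTame_sat hw).or (ψ.isTame_sat hw)
  | .next φ => by
    simpa only [LTLCount.Sat] using
      ((IsTame.lt hw.isSemilinearMap_length).and (φ.isTame_sat hw)).shift
  | .until φ ψ => by
    simpa only [LTLCount.Sat, and_assoc] using
      (φ.isTame_sat hw).strongUntil ((IsTame.lt hw.isSemilinearMap_length).and (ψ.isTame_sat hw))

lemma CountTerm.isTameFun_val (hw : IsTameFamily w) :
    ∀ t : CountTerm A, IsTameFun fun x i ↦ t.val (w x) i
  | .const k => by simpa only [CountTerm.val] using .of_isSemilinearMap (.const k)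
  | .past k φ => by
    classical
    simpa only [CountTerm.val, ← Nat.count_eq_card_filter_range] using
      (IsTameFun.count (φ.isTame_sat hw)).const_mul k
  | .future k φ => by
    classical
    have hφ := (φ.isTame_sat hw).and (IsTame.lt hw.isSemilinearMap_length)
    have total : IsSemilinearMap fun x ↦
        (Nat.count (fun j ↦ φ.Sat (w x) j ∧ j < (w x).length) (w x).length : ℤ) :=
      (hφ.isSemilinearMap_count.comp (.prodMk .id hw.isSemilinearMap_length)).natCast
    simpa only [CountTerm.val, card_filter_Ico_eq_count_sub_count] using
      ((IsTameFun.of_isSemilinearMap total).sub (.count hφ)).const_mul k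
  | .add s t => by simpa only [CountTerm.val] using (s.isTameFun_val hw).add (t.isTameFun_val hw)

end

theorem LTLCount.isSemilinearSet_setOfPred_mem_language (hw : IsTameFamily w) (φ : LTLCount A) :
    IsSemilinearSet {x | w x ∈ φ.language} := by
  have nonempty : IsSemilinearSet {x | w x ≠ []} := by
    simpa only [List.length_pos_iff] using
      IsSemilinearMap.setOfPred_lt (.const 0) hw.isSemilinearMap_length
  have sat : IsSemilinearSet {x | φ.Sat (w x) 0} :=
    IsSemilinearMap.preimage (f := fun x ↦ (x, 0)) (by fun_prop) (φ.isTame_sat hw).isSemilinearSet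
  exact isSemilinearSet_setOfPred_and nonempty sat

end Sat

end IsTame

/-! ### The words `a ^ k b ^ m` -/

/-- The word `a ^ k b ^ m`. -/
def block {A : Type*} (a b : A) (k m : ℕ) : List A :=
  List.replicate k a ++ List.replicate m b

lemma block_zero {A : Type*} (a b : A) (k : ℕ) : block a b k 0 = List.replicate k a :=
  List.append_nil _

lemma block_succ {A : Type*} (a b : A) (k m : ℕ) :
    block a b k (m + 1) = block a b k m ++ [b] := by
  rw [block, block, List.replicate_succ', List.append_assoc]

lemma mem_SQRT_iff (w : List Letter) : w ∈ SQRT ↔ 2 * w.count Letter.a ^ 2 < w.length ^ 2 := by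
  change (w.count Letter.a : ℝ) < (w.length : ℝ) / Real.sqrt 2 ↔ _
  rw [lt_div_iff₀ (by positivity), ← pow_lt_pow_iff_left₀ (by positivity) (by positivity)
    two_ne_zero, mul_pow, Real.sq_sqrt (by norm_num), mul_comm]
  exact_mod_cast Iff.rfl

lemma block_mem_SQRT_iff (k m : ℕ) :
    block Letter.a Letter.b k m ∈ SQRT ↔ 2 * k ^ 2 < (k + m) ^ 2 := by
  simp [mem_SQRT_iff, block, List.count_replicate]

lemma length_eq_count_a_add_count_b (w : List Letter) :
    w.length = w.count Letter.a + w.count Letter.b := by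
  induction w with
  | nil => rfl
  | cons c w ih => cases c <;> simp [ih] <;> lia

theorem not_isSemilinearSet_parikhImage_SQRT : ¬IsSemilinearSet (parikhImage SQRT) := by
  let evalAB : (Letter → ℕ) →+ ℕ × ℕ :=
    (Pi.evalAddMonoidHom _ Letter.a).prod (Pi.evalAddMonoidHom _ Letter.b)
  have image_eq : evalAB '' parikhImage SQRT = {p | 2 * p.1 ^ 2 < (p.1 + p.2) ^ 2} := by
    ext ⟨k, m⟩
    constructor
    · rintro ⟨_, ⟨w, hw, rfl⟩, ⟨⟩⟩
      simpa [mem_SQRT_iff, length_eq_count_a_add_count_b, parikh] using hw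
    · intro h
      exact ⟨_, ⟨_, (block_mem_SQRT_iff k m).2 h, rfl⟩,
        by simp [evalAB, parikh, block, List.count_replicate]⟩
  exact fun h ↦ not_isSemilinearSet_two_mul_sq_lt (image_eq ▸ h.image evalAB)

lemma isTameFamily_block {A : Type*} (a b : A) :
    IsTameFamily fun p : ℕ × ℕ ↦ block a b p.1 p.2 where
  isSemilinearMap_length := by
    simp only [block, List.length_append, List.length_replicate]
    fun_prop
  isTame_letter c := by
    have letter_iff (p : ℕ × ℕ) (i : ℕ) : (block a b p.1 p.2)[i]? = some c ↔
        i < p.1 ∧ a = c ∨ ¬i < p.1 ∧ i < p.1 + p.2 ∧ b = c := by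
      grind [block]
    have tame_const (P : Prop) : IsTame fun (_ : ℕ × ℕ) (_ : ℕ) ↦ P :=
      .of_forall_iff (by by_cases P <;> simp [*, IsSemilinearSet.univ])
    have tame_a : IsTame fun (p : ℕ × ℕ) i ↦ i < p.1 := .lt (by fun_prop)
    have tame_ab : IsTame fun (p : ℕ × ℕ) i ↦ i < p.1 + p.2 := .lt (by fun_prop)
    simpa only [letter_iff] using
      (tame_a.and (tame_const (a = c))).or (tame_a.not.and (tame_ab.and (tame_const (b = c))))

theorem not_isLTLCountDefinable_SQRT : ¬IsLTLCountDefinable SQRT := by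
  rintro ⟨φ, hφ⟩
  refine not_isSemilinearSet_two_mul_sq_lt ?_
  simpa only [hφ, block_mem_SQRT_iff] using
    φ.isSemilinearSet_setOfPred_mem_language (isTameFamily_block Letter.a Letter.b)

/-! ### Simplified multicounter machines on `a ^ k b ^ m` -/

namespace CounterOp

lemma iterate_apply_incr (t : ℕ) (x : ℤ) : incr.apply^[t] x = x + t := by
  induction t with
  | zero => simp
  | succ t ih => rw [Function.iterate_succ_apply', ih, apply]; lia

lemma iterate_apply_decr (t : ℕ) (x : ℤ) : decr.apply^[t] x = x - t := by
  induction t with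
  | zero => simp
  | succ t ih => rw [Function.iterate_succ_apply', ih, apply]; lia

lemma iterate_apply_reset (t : ℕ) (x : ℤ) : reset.apply^[t] x = if t = 0 then x else 0 := by
  cases t with
  | zero => rfl
  | succ t => rw [Function.iterate_succ_apply']; rfl

lemma iterate_apply_noop (t : ℕ) (x : ℤ) : noop.apply^[t] x = x :=
  congrFun (Function.iterate_id t) x

lemma iterate_iterate_apply_eq_zero_iff (o o' : CounterOp) {k k' m : ℕ} (hk : m < k)
    (hk' : m < k') :
    o'.apply^[m] (o.apply^[k] 0) = 0 ↔ o'.apply^[m] (o.apply^[k'] 0) = 0 := by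
  cases o <;> cases o' <;> simp only [iterate_apply_incr, iterate_apply_decr,
    iterate_apply_reset, iterate_apply_noop] <;> grind

end CounterOp

namespace SMCM

variable {A Q : Type} {d : ℕ} (M : SMCM A Q d)

lemma run_append_singleton (w : List A) (c : A) : M.run (w ++ [c]) = M.step (M.run w) c :=
  List.foldl_concat ..

lemma run_replicate_snd (a : A) (k : ℕ) (i : Fin d) :
    (M.run (List.replicate k a)).2 i = (M.update a i).apply^[k] 0 := by
  induction k with
  | zero => rfl
  | succ k ih =>
    rw [List.replicate_succ', run_append_singleton, Function.iterate_succ_apply', ← ih, step]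

lemma run_block_snd (a b : A) (k m : ℕ) (i : Fin d) :
    (M.run (block a b k m)).2 i = (M.update b i).apply^[m] ((M.update a i).apply^[k] 0) := by
  induction m with
  | zero => rw [block_zero, run_replicate_snd, Function.iterate_zero_apply]
  | succ m ih => rw [block_succ, run_append_singleton, Function.iterate_succ_apply', ← ih, step]

lemma mask_run_block (a b : A) {k k' m : ℕ} (hk : m < k) (hk' : m < k') :
    mask (M.run (block a b k m)).2 = mask (M.run (block a b k' m)).2 := by
  funext i
  simp only [mask, run_block_snd, ne_eq,
    (M.update a i).iterate_iterate_apply_eq_zero_iff (M.update b i) hk hk']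

lemma run_block_fst (a b : A) {k k' m : ℕ} (hk : m < k) (hk' : m < k')
    (h : (M.run (List.replicate k a)).1 = (M.run (List.replicate k' a)).1) :
    (M.run (block a b k m)).1 = (M.run (block a b k' m)).1 := by
  induction m with
  | zero => simpa only [block_zero] using h
  | succ m ih =>
    have hk := Nat.lt_of_succ_lt hk
    have hk' := Nat.lt_of_succ_lt hk'
    simp only [block_succ, run_append_singleton, step, ih hk hk', M.mask_run_block a b hk hk']

lemma block_mem_language_iff (a b : A) {k k' m : ℕ} (hk : m < k) (hk' : m < k')
    (h : (M.run (List.replicate k a)).1 = (M.run (List.replicate k' a)).1) :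
    block a b k m ∈ M.language ↔ block a b k' m ∈ M.language := by
  change (_, _) ∈ M.accepting ↔ (_, _) ∈ M.accepting
  rw [M.run_block_fst a b hk hk' h, M.mask_run_block a b hk hk']

end SMCM

theorem not_isSMCMLanguage_SQRT : ¬IsSMCMLanguage SQRT := by
  rintro ⟨Q, _, d, M, hM⟩
  obtain ⟨i, j, hij, same_state⟩ : ∃ i j : ℕ, i < j ∧
      (M.run (List.replicate (2 * 3 ^ i) Letter.a)).1 =
        (M.run (List.replicate (2 * 3 ^ j) Letter.a)).1 := by
    obtain ⟨i, j, hne, h⟩ := Finite.exists_ne_map_eq_of_infinite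
      fun i : ℕ ↦ (M.run (List.replicate (2 * 3 ^ i) Letter.a)).1
    rcases hne.lt_or_gt with hij | hij
    exacts [⟨i, j, hij, h⟩, ⟨j, i, hij, h.symm⟩]
  obtain ⟨m, hm, hm_pos⟩ : ∃ m, 2 * 3 ^ i = m + 1 ∧ 0 < m :=
    ⟨2 * 3 ^ i - 1, by grind [Nat.pow_pos]⟩
  have hj : 3 * (m + 1) ≤ 2 * 3 ^ j := by
    have : 3 ^ (i + 1) ≤ 3 ^ j := Nat.pow_le_pow_right (by lia) hij
    grind
  have mem_iff := M.block_mem_language_iff Letter.a Letter.b (m := m) (by lia) (by lia) same_state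
  rw [hM, block_mem_SQRT_iff, block_mem_SQRT_iff, hm] at mem_iff
  have short_mem : 2 * (m + 1) ^ 2 < (m + 1 + m) ^ 2 := by nlinarith
  have long_not_mem : (2 * 3 ^ j + m) ^ 2 ≤ 2 * (2 * 3 ^ j) ^ 2 := by nlinarith
  exact long_not_mem.not_gt (mem_iff.1 short_mem)

/-! ### A transformer for `SQRT` -/

/-- The attention layer computing `y i = N (x i, x̄)`, where `x̄` is the average of all `x j`:
with zero-dimensional queries and keys all scores are equal. -/
def uniformLayer {d e : ℕ} (N : ReLUNet (d + d) e) : AHALayer d e where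
  keyDim := 0
  valDim := d
  query := AffineMap.const ℚ _ 0
  key := AffineMap.const ℚ _ 0
  value := AffineMap.id ℚ _
  net := N

lemma uniformLayer_eval {d e n : ℕ} (N : ReLUNet (d + d) e) (x : Fin n → Fin d → ℚ) (i : Fin n) :
    (uniformLayer N).eval x i = N.eval (Fin.append (x i) ((n : ℚ)⁻¹ • ∑ j, x j)) := by
  have attended_eq : (uniformLayer N).attended x i = Finset.univ :=
    Finset.filter_true_of_mem fun _ _ _ ↦ le_rfl
  rw [AHALayer.eval, AHALayer.attention, attended_eq, Finset.card_fin]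
  rfl

/-- The network with a single ReLU node, computing `max (0, r + p x + q y)`. -/
def nodeNet (p q r : ℚ) : ReLUNet (1 + 1) 1 :=
  .single fun _ ↦ ⟨![p, q], r⟩

lemma nodeNet_eval (p q r : ℚ) (x y : Fin 1 → ℚ) (c : Fin 1) :
    (nodeNet p q r).eval (Fin.append x y) c = max 0 (r + (p * x 0 + q * y 0)) := by
  change max 0 (r + ∑ i : Fin 2, ![p, q] i * Fin.append x y i) = _
  rw [Fin.sum_univ_two]
  rfl

lemma uniformLayer_nodeNet_eval {n : ℕ} (p q r : ℚ) (x : Fin n → Fin 1 → ℚ) (i : Fin n)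
    (c : Fin 1) :
    (uniformLayer (nodeNet p q r)).eval x i c =
      max 0 (r + (p * x i 0 + q * ((∑ j, x j 0) / n))) := by
  rw [uniformLayer_eval, nodeNet_eval, Pi.smul_apply, Finset.sum_apply, smul_eq_mul,
    inv_mul_eq_div]

/-- A transformer for `SQRT`: with `α` the frequency of the letter `a`, the first layer computes
`α` at the positions labelled `a` and `0` at the others, the second layer averages these values to
`α ^ 2` and outputs `max (0, 1 - 2 α ^ 2)`. -/
def sqrtAHAT : AHAT Letter where
  inDim := 1
  outDim := 0
  embed c _ := if c = Letter.a then 1 else 0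
  posEnc _ _ := 0
  layers := .cons (uniformLayer (nodeNet 1 1 (-1))) (.cons (uniformLayer (nodeNet 0 (-2) 1)) .nil)

lemma sum_ite_getElem_eq {A R : Type*} [DecidableEq A] [AddCommGroupWithOne R] (a : A)
    (w : List A) :
    ∑ i : Fin w.length, (if w[i] = a then (1 : R) else 0) = w.count a := by
  simpa [List.sum_map_ite_eq] using
    Fin.sum_univ_fun_getElem w fun c ↦ if c = a then (1 : R) else 0

lemma sqrtAHAT_layers_eval (w : List Letter) (i : Fin w.length) :
    sqrtAHAT.layers.eval (sqrtAHAT.input w) i 0 =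
      max 0 (1 - 2 * ((w.count Letter.a : ℚ) / w.length) ^ 2) := by
  set α : ℚ := w.count Letter.a / w.length with hα
  have α_nonneg : 0 ≤ α := by positivity
  have α_le_one : α ≤ 1 := div_le_one_of_le₀ (mod_cast List.count_le_length) (by positivity)
  let x (j : Fin w.length) (_ : Fin 1) : ℚ := if w[j] = Letter.a then 1 else 0
  have input_eq : sqrtAHAT.input w = x := funext₂ fun _ _ ↦ add_zero _
  have first_layer (j : Fin w.length) :
      (uniformLayer (nodeNet 1 1 (-1))).eval x j 0 = x j 0 * α := by
    rw [uniformLayer_nodeNet_eval, sum_ite_getElem_eq, ← hα]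
    grind
  rw [input_eq]
  change (uniformLayer (nodeNet 0 (-2) 1)).eval
    ((uniformLayer (nodeNet 1 1 (-1))).eval x) i 0 = _
  rw [uniformLayer_nodeNet_eval]
  simp only [first_layer, ← Finset.sum_mul, x, sum_ite_getElem_eq, mul_div_right_comm, ← hα]
  ring_nf

theorem sqrtAHAT_language : sqrtAHAT.language = SQRT := by
  have mem_iff {w : List Letter} (hw : w ≠ []) :
      0 < max 0 (1 - 2 * ((w.count Letter.a : ℚ) / w.length) ^ 2) ↔
        2 * w.count Letter.a ^ 2 < w.length ^ 2 := by
    have : (0 : ℚ) < w.length := mod_cast List.length_pos_iff.2 hw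
    rw [lt_max_iff, or_iff_right (lt_irrefl _), sub_pos, div_pow, ← mul_div_assoc,
      div_lt_one (by positivity)]
    norm_cast
  ext w
  rw [mem_SQRT_iff]
  constructor
  · rintro ⟨hw, h⟩
    exact (mem_iff hw).1 ((sqrtAHAT_layers_eval w _).symm ▸ h)
  · intro h
    have hw : w ≠ [] := by rintro rfl; simp at h
    exact ⟨hw, (sqrtAHAT_layers_eval w _).symm ▸ (mem_iff hw).2 h⟩

end CountLang

theorem mainTheorem7 :
    (∃ T : CountLang.AHAT CountLang.Letter,
      T.IsNoPE ∧ T.numLayers = 2 ∧ T.language = CountLang.SQRT) ∧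
    ¬ IsSemilinearSet (CountLang.parikhImage CountLang.SQRT) ∧
    ¬ CountLang.IsLTLCountDefinable CountLang.SQRT ∧
    ¬ CountLang.IsSMCMLanguage CountLang.SQRT :=
  ⟨⟨CountLang.sqrtAHAT, ⟨0, fun _ _ ↦ rfl⟩, rfl, CountLang.sqrtAHAT_language⟩,
    CountLang.not_isSemilinearSet_parikhImage_SQRT, CountLang.not_isLTLCountDefinable_SQRT,
    CountLang.not_isSMCMLanguage_SQRT⟩
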